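/- Let $G=(V,E)$ be any digraph (possibly infinite, $E\subseteq\{(u,v)\in V\times V: u\ne v\}$), let $p$ be a prime, $R=\mathbb Z_p$ the field with $p$ elements, and $n\ge 0$ an integer. **Path chains.** For $k\ge0$ let $\Lambda_k$ be the free $R$-module on sequences $e_{v_0,\dots,v_k}$ of vertices, $\Lambda_k=0$ for $k<0$, with differential $\partial e_{v_0,\dots,v_k}=\sum_i(-1)^i e_{v_0,\dots,\hat v_i,\dots,v_k}$. A sequence is irregular if two consecutive vertices are equal and allowed if $(v_{i-1},v_i)\in E$ for all $i$. Let $\mathcal A_k$ be the span of the allowed sequences in $\Lambda_k$ modulo the span of the irregular ones, and $\Omega_k=\Omega_k(G;R)=\{x\in\mathcal A_k:\partial x\in\mathcal A_{k-1}\}$. Let $\bar h(x)$ be the set of last vertices of the paths occurring in $x$ with nonzero coefficient. For $u\in V$ let $\delta_u(x)$ be obtained from $x\in\mathcal A_k$ by deleting the last vertex of every path whose last but one vertex is $u$ and dropping the other paths (so $\delta_u=0$ for $k=0$). For $v\in V$ let $[x]^v$ be obtained by appending $v$ to every path of $x$ for which the result is allowed, and dropping the other paths. **Face multihypergraphs.**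 An (upper) face multihypergraph $F$ on $x_1,\dots,x_m\in\Omega_k$ (where $x_i\neq -x_j$ for $i\ne j$; repetitions are allowed) consists of the following. For all $u\in V$ and $i$ with $\delta_u(x_i)\neq0$ there is a chosen decomposition $\delta_u(x_i)=x_i^{u,1}+\dots+x_i^{u,m_i^u}$ in $\Omega_{k-1}$, no nonempty subsequence of which sums to zero. The vertices of $F$ are $1,\dots,m$, vertex $i$ being labeled $x_i$. Each hyperedge of $F$ is labeled by some $u\in V$ and a set of summands $x_{i_1}^{u,k_1},\dots,x_{i_t}^{u,k_t}$ (distinct index pairs $(i_j,k_j)$), joins the vertices $i_1,\dots,i_t$, and is either an *edge*: $t=2$, $i_1\ne i_2$ and $x_{i_1}^{u,k_1}=-x_{i_2}^{u,k_2}$; or has $t\ge3$, the $i_j$ are not all equal, $x_{i_1}^{u,k_1}=\dots=x_{i_t}^{u,k_t}$ and $x_{i_1}^{u,k_1}+\dots+x_{i_t}^{u,k_t}=0$. Every summand $x_i^{u,k}$ appears in at most one hyperedge label. A *mutation* of $F$ is a face multihypergraph with the same $x_i$ and the same decompositions, obtained by one of the following replacements of hyperedges with the same $u$: two edges $\{a,b\},\{c,d\}$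 by $\{a,d\},\{b,c\}$ or by $\{a,c\},\{b,d\}$; two hyperedges $\{a_1,\dots,a_t\},\{b_1,\dots,b_t\}$, $t\ge3$, by the $t$ edges $\{a_j,b_j\}$, or the reverse; two hyperedges of the same size $t\ge3$ by two hyperedges of size $t$ with the same $2t$ summands in total. $F$ is *strongly connected* if every face multihypergraph reachable from $F$ by a finite sequence of mutations (including $F$) is connected as a hypergraph. For $v\in V$, $[x_1+\dots+x_m]^v$ is an *extension by $v$ over $F$* if $(w,v)\in E$ for all $w\in\bar h(x_i)$ and all $i$. It is *$v$-complete* if every hyperedge label has $(u,v)\notin E$ and $u\neq v$, and conversely, for all $i$ and all $u\ne v$ with $\delta_u(x_i)\neq0$ and $(u,v)\notin E$, every $x_i^{u,k}$ appears in a hyperedge label. **Inductive elements.** Let $\bar E^h_{-1}=\emptyset$ and $\bar E^h_0=\{\pm e_v: v\in V\}$. For $k\ge1$ let $\bar E^h_k$ be the set of those $x\in\Omega_k$ with $\bar h(x)=\{v\}$ for some vertex $v$ that are extensions by $v$ over a strongly connected $v$-complete face multihypergraph on some $x_1,\dots,x_m\in\Omega_{k-1}$ such that all $x_i$ lie in $\bar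 E^h_{k-1}$ up to sign and all summands $x_i^{u,l}$ lie in $\bar E^h_{k-2}$ up to sign. These are the $k$-dimensional upper inductive elements. The $k$-dimensional lower inductive elements $\bar E^t_k$ are defined in the same way with first vertices in place of last vertices and all edges reversed (delete the first vertex of the paths whose second vertex is $u$; prepend $v$; require $(v,w)\in E$ for all first vertices $w$ of the $x_i$; replace the conditions on $(u,v)$ by those on $(v,u)$). **Claim.** The upper inductive elements $\bar E^h_n$ span $\Omega_n(G;\mathbb Z_p)$, and so do the lower inductive elements $\bar E^t_n$. Moreover, each of $\bar E^h_n$ and $\bar E^t_n$ contains a subset that is a basis of $\Omega_n(G;\mathbb Z_p)$. -/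

import Mathlib

open scoped BigOperators

namespace DigraphPath

section Chains

variable {V : Type*} (G : Digraph V) (R : Type*) [CommRing R]

/-- The free `R`-module on all finite sequences of elements of `V`. The sequence `[v₀, …, vₙ]`
is the elementary path `e_{v₀,…,vₙ}`, so that the part supported on sequences of length `n + 1`
is the module `Λ_n(V; R)`. -/
abbrev Chain (V : Type*) (R : Type*) [CommRing R] : Type _ := List V →₀ R

/-- The path differential `∂ e_{v₀,…,vₙ} = ∑ᵢ (-1)ⁱ e_{v₀,…,v̂ᵢ,…,vₙ}`, with `∂ e_{v₀} = 0`
since `Λ_{-1} = 0`. -/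
noncomputable def pathDifferential (V : Type*) (R : Type*) [CommRing R] :
    Chain V R →ₗ[R] Chain V R :=
  Finsupp.linearCombination R fun l : List V =>
    if l.length ≤ 1 then 0
    else ∑ i ∈ Finset.range l.length, (-1 : R) ^ i • Finsupp.single (l.eraseIdx i) (1 : R)

/-- The span of the irregular elementary paths: those with two equal consecutive vertices. -/
def irregular (V : Type*) (R : Type*) [CommRing R] : Submodule R (Chain V R) :=
  Finsupp.supported R R {l : List V | ¬ l.IsChain (· ≠ ·)}

/-- `l` is an allowed `n`-path of `G`: a sequence of `n + 1` vertices, `n ≥ 0`, in which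
consecutive vertices are joined by an edge. There is none for `n < 0`. -/
def IsAllowed (n : ℤ) (l : List V) : Prop :=
  l ≠ [] ∧ (l.length : ℤ) = n + 1 ∧ l.IsChain G.Adj

/-- The module `𝒜_n(G; R)`, written through the unique allowed representatives. -/
def allowedChains (n : ℤ) : Submodule R (Chain V R) :=
  Finsupp.supported R R {l : List V | IsAllowed G n l}

/-- The path chains `Ω_n(G; R)`: the `x ∈ 𝒜_n(G; R)` whose path differential, taken in the
quotient by the irregular paths, lies in (the image of) `𝒜_{n-1}(G; R)`.
It is `0` for `n < 0`. -/
noncomputable def pathChains (n : ℤ) : Submodule R (Chain V R) :=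
  allowedChains G R n ⊓
    ((allowedChains G R (n - 1)).map (irregular V R).mkQ).comap
      ((irregular V R).mkQ ∘ₗ pathDifferential V R)

end Chains

/-- Upper constructions work at the last vertex of paths, lower ones at the first vertex. -/
inductive Side : Type
  | upper : Side
  | lower : Side

section Faces

variable {V : Type*} (G : Digraph V) {R : Type*} [CommRing R]

/-- The head set (upper) or the tail set (lower) of a chain: the set of last (first) vertices of
the paths occurring in it. -/
def endSet : Side → Chain V R → Set V
  | Side.upper, x => {v | ∃ l ∈ x.support, l.getLast? = some v}
  | Side.lower, x => {v | ∃ l ∈ x.support, l.head? = some v}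

/-- `w → v` is an edge (upper), respectively `v → w` is an edge (lower). -/
def Joins : Side → V → V → Prop
  | Side.upper, w, v => G.Adj w v
  | Side.lower, w, v => G.Adj v w

open Classical in
/-- The face map `δ^h_{n,u}` (upper): delete the last vertex of those paths whose last but one
vertex is `u`, and drop all other paths. The face map `δ^t_{n,u}` (lower): delete the first
vertex of those paths whose second vertex is `u`. Both vanish on paths with a single vertex. -/
noncomputable def faceMap : Side → V → Chain V R →ₗ[R] Chain V R
  | Side.upper, u => Finsupp.linearCombination R fun l : List V =>
      if l.dropLast.getLast? = some u then Finsupp.single l.dropLast (1 : R) else 0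
  | Side.lower, u => Finsupp.linearCombination R fun l : List V =>
      if l.tail.head? = some u then Finsupp.single l.tail (1 : R) else 0

open Classical in
/-- The upper extension `[x]^v` and the lower extension `[x]_v`: append (prepend) `v` to every
path for which the result is again an allowed path, and drop the other paths. -/
noncomputable def extension : Side → V → Chain V R →ₗ[R] Chain V R
  | Side.upper, v => Finsupp.linearCombination R fun l : List V =>
      if (l ++ [v]).IsChain G.Adj then Finsupp.single (l ++ [v]) (1 : R) else 0
  | Side.lower, v => Finsupp.linearCombination R fun l : List V =>
      if (v :: l).IsChain G.Adj then Finsupp.single (v :: l) (1 : R) else 0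

end Faces

section FaceMultihypergraphs

variable {V : Type*} {G : Digraph V} {R : Type*} [CommRing R] {s : Side} {n : ℤ}

/-- The elements `x_1, …, x_m` of `Ω_n(G; R)` together with the chosen decompositions
`δ_{n,u}(x_i) = x_i^{u,1} + ⋯ + x_i^{u,m_i^u}` in `Ω_{n-1}(G; R)`, no nonempty subsequence of
which sums to zero. (If `δ_{n,u}(x_i) = 0` this forces `m_i^u = 0`.) -/
structure FaceData (G : Digraph V) (R : Type*) [CommRing R] (s : Side) (n : ℤ) where
  m : ℕ
  x : Fin m → Chain V R
  x_mem : ∀ i, x i ∈ pathChains G R n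
  x_ne_neg : ∀ i j, i ≠ j → x i ≠ -x j
  count : Fin m → V → ℕ
  part : (i : Fin m) → (u : V) → Fin (count i u) → Chain V R
  part_mem : ∀ i u k, part i u k ∈ pathChains G R (n - 1)
  sum_part : ∀ i u, ∑ k, part i u k = faceMap s u (x i)
  no_zero_sum : ∀ i u (S : Finset (Fin (count i u))), S.Nonempty → ∑ k ∈ S, part i u k ≠ 0

/-- The index pairs `(i, k)` of the summands `x_i^{u,k}` for a fixed `u`. -/
abbrev FaceData.Slot (D : FaceData G R s n) (u : V) : Type :=
  (i : Fin D.m) × Fin (D.count i u)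

/-- The summand `x_i^{u,k}`. -/
def FaceData.val (D : FaceData G R s n) {u : V} (a : D.Slot u) : Chain V R :=
  D.part a.1 u a.2

/-- Labels `({x_{i_1}^{u,k_1}, …, x_{i_t}^{u,k_t}}, u)`; the summands are recorded by their
indices, as equal chains may occur at several places. The hyperedge carrying the label consists
of the vertices `i_1, …, i_t`. -/
abbrev FaceData.Label (D : FaceData G R s n) : Type _ := (u : V) × Finset (D.Slot u)

/-- The labels that edges may carry: two summands, at distinct vertices, opposite to each
other. -/
def FaceData.IsEdge (D : FaceData G R s n) (e : D.Label) : Prop :=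
  ∃ a b : D.Slot e.1, e.2 = {a, b} ∧ a.1 ≠ b.1 ∧ D.val a = -D.val b

/-- The labels that larger hyperedges may carry: at least three summands, not all at the same
vertex, all equal to each other and with sum zero. -/
def FaceData.IsLargeHyperedge (D : FaceData G R s n) (e : D.Label) : Prop :=
  3 ≤ e.2.card ∧ (∃ a ∈ e.2, ∃ b ∈ e.2, a.1 ≠ b.1) ∧
    (∀ a ∈ e.2, ∀ b ∈ e.2, D.val a = D.val b) ∧ ∑ a ∈ e.2, D.val a = 0

/-- A face multihypergraph on the given data. Its vertices are `Fin D.m`, the vertex `i` being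
labeled by `x_i`. Since a summand appears in at most one hyperedge label, the hyperedges are
given by the set of their labels. -/
structure FaceMultihypergraph (D : FaceData G R s n) where
  edges : Set D.Label
  valid : ∀ e ∈ edges, D.IsEdge e ∨ D.IsLargeHyperedge e
  unique : ∀ (u : V) (S T : Finset (D.Slot u)), (⟨u, S⟩ : D.Label) ∈ edges →
    (⟨u, T⟩ : D.Label) ∈ edges → ∀ a, a ∈ S → a ∈ T → S = T

namespace FaceMultihypergraph

variable {D : FaceData G R s n}

/-- The vertices `i` and `j` lie in a common hyperedge. -/
def Linked (F : FaceMultihypergraph D) (i j : Fin D.m) : Prop :=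
  ∃ e ∈ F.edges, (∃ a ∈ e.2, a.1 = i) ∧ ∃ b ∈ e.2, b.1 = j

/-- Any two vertices are joined by a sequence of hyperedges, consecutive ones of which meet. -/
def Connected (F : FaceMultihypergraph D) : Prop :=
  ∀ i j, Relation.ReflTransGen F.Linked i j

/-- Mutations between face multihypergraphs on the same data. As `{c, d} = {d, c}`, the first
constructor covers both ways of re-pairing two edges. -/
inductive Mutation : FaceMultihypergraph D → FaceMultihypergraph D → Prop
  /-- Edges `{a, b}`, `{c, d}` are replaced by `{a, d}`, `{b, c}`. -/
  | edges (F F' : FaceMultihypergraph D) (u : V) (a b c d : D.Slot u)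
      (h₁ : (⟨u, {a, b}⟩ : D.Label) ∈ F.edges) (h₂ : (⟨u, {c, d}⟩ : D.Label) ∈ F.edges)
      (hab : a ≠ b) (hcd : c ≠ d) (hne : ({a, b} : Finset (D.Slot u)) ≠ {c, d})
      (h : F'.edges = (F.edges \ {⟨u, {a, b}⟩, ⟨u, {c, d}⟩}) ∪ {⟨u, {a, d}⟩, ⟨u, {b, c}⟩}) :
      Mutation F F'
  /-- Two hyperedges of the same size `t ≥ 3` are replaced by `t` edges. -/
  | split (F F' : FaceMultihypergraph D) (u : V) (t : ℕ) (ht : 3 ≤ t) (a b : Fin t ↪ D.Slot u)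
      (h₁ : (⟨u, Finset.univ.map a⟩ : D.Label) ∈ F.edges)
      (h₂ : (⟨u, Finset.univ.map b⟩ : D.Label) ∈ F.edges)
      (hne : Finset.univ.map a ≠ Finset.univ.map b)
      (h : F'.edges = (F.edges \ {⟨u, Finset.univ.map a⟩, ⟨u, Finset.univ.map b⟩}) ∪
        Set.range fun j : Fin t => (⟨u, {a j, b j}⟩ : D.Label)) :
      Mutation F F'
  /-- The reverse replacement. -/
  | merge (F F' : FaceMultihypergraph D) (u : V) (t : ℕ) (ht : 3 ≤ t) (a b : Fin t ↪ D.Slot u)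
      (h₁ : ∀ j : Fin t, (⟨u, {a j, b j}⟩ : D.Label) ∈ F.edges)
      (hne : Finset.univ.map a ≠ Finset.univ.map b)
      (h : F'.edges = (F.edges \ Set.range fun j : Fin t => (⟨u, {a j, b j}⟩ : D.Label)) ∪
        {⟨u, Finset.univ.map a⟩, ⟨u, Finset.univ.map b⟩}) :
      Mutation F F'
  /-- The summands of two hyperedges of the same size `t ≥ 3` are redistributed over two
  hyperedges of size `t`. -/
  | redistribute (F F' : FaceMultihypergraph D) (u : V) (t : ℕ) (ht : 3 ≤ t)
      (S S' T T' : Finset (D.Slot u))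
      (h₁ : (⟨u, S⟩ : D.Label) ∈ F.edges) (h₂ : (⟨u, S'⟩ : D.Label) ∈ F.edges) (hne : S ≠ S')
      (hS : S.card = t) (hS' : S'.card = t) (hT : T.card = t) (hT' : T'.card = t)
      (hdisj : Disjoint T T') (hunion : T ∪ T' = S ∪ S')
      (h : F'.edges = (F.edges \ {⟨u, S⟩, ⟨u, S'⟩}) ∪ {⟨u, T⟩, ⟨u, T'⟩}) :
      Mutation F F'

/-- The face multihypergraph and all face multihypergraphs mutation equivalent to it are
connected. -/
def StronglyConnected (F : FaceMultihypergraph D) : Prop :=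
  ∀ F' : FaceMultihypergraph D, Relation.EqvGen Mutation F F' → F'.Connected

/-- Every hyperedge belongs to some `u ≠ v` not joined to `v`. -/
def Proper (F : FaceMultihypergraph D) (v : V) : Prop :=
  ∀ e ∈ F.edges, ¬ Joins G s e.1 v ∧ e.1 ≠ v

/-- `F` is `v`-proper, and for every `u ≠ v` not joined to `v` each summand `x_i^{u,k}` of a
nonzero `δ_{n,u}(x_i)` appears in a hyperedge label. -/
def Complete (F : FaceMultihypergraph D) (v : V) : Prop :=
  F.Proper v ∧
    ∀ (i : Fin D.m) (u : V), faceMap s u (D.x i) ≠ 0 → u ≠ v → ¬ Joins G s u v →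
      ∀ k : Fin (D.count i u), ∃ S : Finset (D.Slot u),
        (⟨u, S⟩ : D.Label) ∈ F.edges ∧ (⟨i, k⟩ : D.Slot u) ∈ S

end FaceMultihypergraph

/-- The condition for `[x_1 + ⋯ + x_m]^v` (or `[x_1 + ⋯ + x_m]_v`) to be an extension by `v`
over a face multihypergraph: `v` is joined to all heads (tails) of all the `x_i`. -/
def FaceData.Extends (D : FaceData G R s n) (v : V) : Prop :=
  ∀ i, ∀ w ∈ endSet s (D.x i), Joins G s w v

/-- `x` is, up to sign, an element of `E`. -/
def UpToSign (E : Set (Chain V R)) (x : Chain V R) : Prop := x ∈ E ∨ -x ∈ E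

/-- `x ∈ Ω_n(G; R)` is upper (lower) `(E, E')`-inductive, where `E` and `E'` are sets of chains
of dimensions `n - 1` and `n - 2`: it has a unique head (tail) `v`, and it is the upper (lower)
extension by `v` over a strongly connected `v`-complete face multihypergraph whose vertices are
labeled by elements of `± E` and whose decompositions have summands in `± E'`. -/
def IsInductive (G : Digraph V) (s : Side) (n : ℤ) (E E' : Set (Chain V R)) (x : Chain V R) :
    Prop :=
  x ∈ pathChains G R n ∧ ∃ v : V, endSet s x = {v} ∧
    ∃ (D : FaceData G R s (n - 1)) (F : FaceMultihypergraph D),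
      D.Extends v ∧ x = extension G s v (∑ i, D.x i) ∧ F.Complete v ∧ F.StronglyConnected ∧
        (∀ i, UpToSign E (D.x i)) ∧ ∀ i u k, UpToSign E' (D.part i u k)

/-- The `n`-dimensional upper (lower) inductive elements. In dimension `-1` there are none. -/
def inductiveElements (G : Digraph V) (R : Type*) [CommRing R] (s : Side) :
    ℕ → Set (Chain V R)
  | 0 => {x | ∃ v : V, x = Finsupp.single [v] 1 ∨ x = -Finsupp.single [v] 1}
  | 1 => {x | IsInductive G s 1 (inductiveElements G R s 0) ∅ x}
  | n + 2 => {x | IsInductive G s ((n + 2 : ℕ) : ℤ)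
      (inductiveElements G R s (n + 1)) (inductiveElements G R s n) x}

end FaceMultihypergraphs

end DigraphPath

/-!
The condition `∂x ∈ 𝒜_{n-1}` on an allowed chain `x` says that for every broken path `αβ`, with no
edge between `α` and `β`, the coefficients of the paths `αwβ` in `x` sum to zero. Write `x` as the
sum over `v` of the extensions `[y_v]^v`. If `β` does not consist of `v` alone, the condition says
that `y_v ∈ Ω_{n-1}`; if it does, it says that the faces `δ_u y_v` vanish for all `u ≠ v` not joined
to `v`. Hence `Ω_n` is spanned by the extensions `[y]^v` of such `y`.

A scalar of `ℤ_p` is a repeated sum, so `y` is a sum of inductive elements `x_i`, and their faces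
are sums of members of a fixed basis of `Ω_{n-2}`. As `δ_u y = 0`, each basis member occurs a
multiple of `p` times among the summands of the `δ_u x_i`. Grouping its occurrences into
sets of size `p` yields hyperedges (edges if `p = 2`), and a `v`-complete face multihypergraph.
Being `v`-complete depends only on the set of summands covered by hyperedges, which mutations
preserve. So if some mutation is disconnected, then the sums over its components again have
extensions by `v`, with fewer summands, and induction on the number of summands applies.
-/

namespace DigraphPath

/-! ### Paths seen from either end -/

namespace Side

variable {V : Type*}

/-- Attach a vertex at the end of a path where the constructions of the side operate: after the
last vertex for the upper side, before the first one for the lower side. -/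
def snoc : Side → List V → V → List V
  | upper, l, v => l ++ [v]
  | lower, l, v => v :: l

/-- The vertex of a path at the end where the constructions of the side operate. -/
def last? : Side → List V → Option V
  | upper, l => l.getLast?
  | lower, l => l.head?

/-- The vertex of a path at the end opposite to `Side.last?`. -/
def first? : Side → List V → Option V
  | upper, l => l.head?
  | lower, l => l.getLast?

/-- The path running through `α`, then `w`, then `β`, where `β` is at the end at which the
constructions of the side operate. The interpolated vertex is the last argument, so that
`s.bridge α β` is the family of all such paths. -/
def bridge : Side → List V → List V → V → List V
  | upper, α, β, w => α ++ w :: β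
  | lower, α, β, w => β ++ w :: α

variable (s : Side)

theorem snoc_inj {l l' : List V} {v v' : V} :
    s.snoc l v = s.snoc l' v' ↔ l = l' ∧ v = v' := by
  cases s <;> simp [snoc, and_comm]

theorem snoc_ne_nil (l : List V) (v : V) : s.snoc l v ≠ [] := by
  cases s <;> simp [snoc]

theorem length_snoc (l : List V) (v : V) : (s.snoc l v).length = l.length + 1 := by
  cases s <;> simp [snoc]

theorem eq_nil_or_eq_snoc (l : List V) : l = [] ∨ ∃ l' v, l = s.snoc l' v := by
  rcases eq_or_ne l [] with hl | hl
  · exact .inl hl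
  · cases s
    · exact .inr ⟨l.dropLast, l.getLast hl, (List.dropLast_append_getLast hl).symm⟩
    · exact .inr ⟨l.tail, l.head hl, (List.cons_head_tail hl).symm⟩

theorem last?_nil : s.last? ([] : List V) = none := by
  cases s <;> rfl

theorem first?_nil : s.first? ([] : List V) = none := by
  cases s <;> rfl

theorem last?_snoc (l : List V) (v : V) : s.last? (s.snoc l v) = some v := by
  cases s <;> simp [snoc, last?]

theorem first?_snoc_nil (v : V) : s.first? (s.snoc [] v) = some v := by
  cases s <;> simp [snoc, first?]

theorem first?_snoc {l : List V} (hl : l ≠ []) (v : V) :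
    s.first? (s.snoc l v) = s.first? l := by
  cases s <;> cases l <;> simp_all [snoc, first?]

theorem bridge_nil (α : List V) (w : V) : s.bridge α [] w = s.snoc α w := by
  cases s <;> simp [snoc, bridge]

theorem bridge_snoc (α β : List V) (v w : V) :
    s.bridge α (s.snoc β v) w = s.snoc (s.bridge α β w) v := by
  cases s <;> simp [snoc, bridge]

theorem bridge_injective (α β : List V) : Function.Injective (s.bridge α β) := by
  intro w w' h
  cases s <;> simpa [bridge] using h

theorem last?_bridge (α : List V) {β : List V} (hβ : β ≠ []) (w : V) :
    s.last? (s.bridge α β w) = s.last? β := by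
  obtain rfl | ⟨β', v, rfl⟩ := s.eq_nil_or_eq_snoc β
  · exact absurd rfl hβ
  · rw [bridge_snoc, last?_snoc, last?_snoc]

theorem isChain_snoc (G : Digraph V) (l : List V) (v : V) :
    (s.snoc l v).IsChain G.Adj ↔
      l.IsChain G.Adj ∧ ∀ w, s.last? l = some w → Joins G s w v := by
  cases s
  · simp [snoc, last?, Joins, List.isChain_append]
  · simp [snoc, last?, Joins, List.isChain_cons, and_comm]

end Side

section Broken

variable {V : Type*} {G : Digraph V} {s : Side} {n : ℤ} {α β γ δ l : List V}

theorem isAllowed_snoc {v : V} (hn : 1 ≤ n) :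
    IsAllowed G n (s.snoc l v) ↔
      IsAllowed G (n - 1) l ∧ ∀ w, s.last? l = some w → Joins G s w v := by
  simp only [IsAllowed, s.isChain_snoc, s.length_snoc, ← List.length_pos_iff]
  grind

/-- The concatenation of `α` and `β`, seen from the side, fails to be a path at the junction: the
two vertices that meet there are distinct and not joined. -/
def IsBroken (G : Digraph V) (s : Side) (α β : List V) : Prop :=
  ∃ a b, s.last? α = some a ∧ s.first? β = some b ∧ a ≠ b ∧ ¬ Joins G s a b

theorem isBroken_lower : IsBroken G Side.lower α β ↔ IsBroken G Side.upper β α := by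
  constructor <;>
  · rintro ⟨a, b, ha, hb, hab, hj⟩
    exact ⟨b, a, hb, ha, hab.symm, hj⟩

theorem IsBroken.left_ne_nil (h : IsBroken G s α β) : α ≠ [] := by
  rintro rfl
  obtain ⟨a, b, ha, -⟩ := h
  simp [s.last?_nil] at ha

theorem IsBroken.right_ne_nil (h : IsBroken G s α β) : β ≠ [] := by
  rintro rfl
  obtain ⟨a, b, -, hb, -⟩ := h
  simp [s.first?_nil] at hb

theorem isBroken_snoc (hβ : β ≠ []) (v : V) :
    IsBroken G s α (s.snoc β v) ↔ IsBroken G s α β := by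
  simp only [IsBroken, s.first?_snoc hβ]

theorem isBroken_snoc_nil {v : V} :
    IsBroken G s α (s.snoc [] v) ↔ ∃ u, s.last? α = some u ∧ u ≠ v ∧ ¬ Joins G s u v := by
  simp [IsBroken, s.first?_snoc_nil]

theorem IsBroken.not_isChain (h : IsBroken G Side.upper α β) : ¬ (α ++ β).IsChain G.Adj := by
  obtain ⟨a, b, ha, hb, -, hj⟩ := h
  exact fun hc => hj ((List.isChain_append.1 hc).2.2 a ha b hb)

theorem IsBroken.isChain_ne_append {w : V} (h : IsBroken G Side.upper α β)
    (hc : (α ++ w :: β).IsChain (· ≠ ·)) : (α ++ β).IsChain (· ≠ ·) := by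
  obtain ⟨a, b, ha, hb, hab, -⟩ := h
  obtain ⟨hα, hβ, -⟩ := List.isChain_append.1 hc
  refine List.isChain_append.2 ⟨hα, hβ.tail, fun a' ha' b' hb' => ?_⟩
  obtain rfl : a = a' := Option.some_injective _ (ha.symm.trans ha')
  obtain rfl : b = b' := Option.some_injective _ (hb.symm.trans hb')
  exact hab

theorem IsBroken.of_append_left (h : IsBroken G Side.upper (γ ++ α) β) (hα : α ≠ []) :
    IsBroken G Side.upper α β := by
  simpa only [IsBroken, Side.last?, List.getLast?_append_of_ne_nil _ hα] using h

theorem IsBroken.of_append_right (h : IsBroken G Side.upper α (β ++ γ)) (hβ : β ≠ []) :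
    IsBroken G Side.upper α β := by
  simpa only [IsBroken, Side.first?, List.head?_append_of_ne_nil _ hβ] using h

theorem IsBroken.eq_of_append_eq_append (h : IsBroken G Side.upper α β)
    (hγ : γ.IsChain G.Adj) (hδ : δ.IsChain G.Adj) (he : γ ++ δ = α ++ β) : γ = α ∧ δ = β := by
  rcases List.append_eq_append_iff.1 he with ⟨ε, rfl, rfl⟩ | ⟨ε, rfl, rfl⟩ <;>
    rcases eq_or_ne ε [] with rfl | hε
  · simp
  · exact absurd hδ (h.of_append_left hε).not_isChain
  · simp
  · exact absurd hγ (h.of_append_right hε).not_isChain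

theorem IsBroken.eraseIdx_eq_iff (h : IsBroken G Side.upper α β) (hl : l.IsChain G.Adj) {i : ℕ}
    (hi : i < l.length) : l.eraseIdx i = α ++ β ↔ i = α.length ∧ ∃ w, l = α ++ w :: β := by
  constructor
  · intro he
    rw [List.eraseIdx_eq_take_drop_succ] at he
    obtain ⟨hα, hβ⟩ := h.eq_of_append_eq_append (hl.take i) (hl.drop (i + 1)) he
    refine ⟨by simp [← hα, hi.le], l[i], ?_⟩
    simp [← hα, ← hβ]
  · rintro ⟨rfl, w, rfl⟩
    simp [List.eraseIdx_append_of_length_le]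

theorem exists_isBroken_of_not_isChain (hl : ¬ l.IsChain G.Adj)
    (hreg : l.IsChain (· ≠ ·)) : ∃ α β, l = α ++ β ∧ IsBroken G Side.upper α β := by
  simp only [List.isChain_iff_forall_rel_of_append_cons_cons] at hl hreg
  push Not at hl
  obtain ⟨a, b, l₁, l₂, rfl, hab⟩ := hl
  exact ⟨l₁ ++ [a], b :: l₂, by simp, a, b, by simp [Side.last?], rfl, hreg rfl, hab⟩

end Broken

/-! ### Path chains and missing edges -/

section BridgeSum

variable {V : Type*} {G : Digraph V} {R : Type*} [CommRing R] {s : Side} {n : ℤ}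
  {α β : List V} {x : Chain V R}

/-- The sum over all `w` of the coefficients of the paths that run through `α`, then `w`, then
`β`, seen from the side. -/
noncomputable def bridgeSum (R : Type*) [CommRing R] (s : Side) (α β : List V) :
    Chain V R →ₗ[R] R :=
  Finsupp.linearCombination R (fun _ : V => (1 : R)) ∘ₗ
    Finsupp.lcomapDomain (s.bridge α β) (s.bridge_injective α β)

theorem bridgeSum_congr {t : Side} {α' β' : List V} {y : Chain V R}
    (h : ∀ w, x (s.bridge α β w) = y (t.bridge α' β' w)) :
    bridgeSum R s α β x = bridgeSum R t α' β' y := by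
  simp only [bridgeSum, LinearMap.comp_apply]
  congr 1
  ext w
  exact h w

theorem bridgeSum_eq_zero (h : ∀ w, x (s.bridge α β w) = 0) : bridgeSum R s α β x = 0 :=
  (bridgeSum_congr (t := s) (α' := α) (β' := β) (y := 0) h).trans (map_zero _)

theorem bridgeSum_eq_apply (v : V) (h : ∀ w, w ≠ v → x (s.bridge α β w) = 0) :
    bridgeSum R s α β x = x (s.bridge α β v) := by
  have hcomap : Finsupp.lcomapDomain (M := R) (R := R) (s.bridge α β) (s.bridge_injective α β) x =
      Finsupp.single v (x (s.bridge α β v)) := by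
    ext w
    rcases eq_or_ne w v with rfl | hw
    · simp [Finsupp.lcomapDomain]
    · rw [Finsupp.single_eq_of_ne hw]
      exact h w hw
  simp [bridgeSum, hcomap]

theorem bridgeSum_single_bridge (s : Side) (α β : List V) (w : V) (c : R) :
    bridgeSum R s α β (Finsupp.single (s.bridge α β w) c) = c := by
  rw [bridgeSum_eq_apply w, Finsupp.single_eq_same]
  exact fun w' hw' => Finsupp.single_eq_of_ne fun h => hw' (s.bridge_injective _ _ h)

theorem bridgeSum_single_of_forall_ne {l : List V} (h : ∀ w, l ≠ s.bridge α β w) (c : R) :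
    bridgeSum R s α β (Finsupp.single l c) = 0 :=
  bridgeSum_eq_zero fun w => Finsupp.single_eq_of_ne (h w).symm

theorem mem_allowedChains : x ∈ allowedChains G R n ↔ ∀ l, x l ≠ 0 → IsAllowed G n l := by
  simp only [allowedChains, Finsupp.mem_supported, Set.subset_def, Finset.mem_coe,
    Finsupp.mem_support_iff, Set.mem_ofPred_eq]

theorem eqOn_allowedChains {M : Type*} [AddCommGroup M] [Module R M] {f g : Chain V R →ₗ[R] M}
    (h : ∀ l, IsAllowed G n l → f (Finsupp.single l 1) = g (Finsupp.single l 1))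
    (hx : x ∈ allowedChains G R n) : f x = g x := by
  rw [allowedChains, Finsupp.supported_eq_span_single] at hx
  refine LinearMap.eqOn_span ?_ hx
  rintro _ ⟨l, hl, rfl⟩
  exact h l hl

theorem pathDifferential_apply_nil (x : Chain V R) : pathDifferential V R x [] = 0 := by
  classical
  induction x using Finsupp.induction_linear with
  | zero => simp
  | add y z hy hz => rw [map_add, Finsupp.add_apply, hy, hz, add_zero]
  | single l c =>
    rw [pathDifferential, Finsupp.linearCombination_single]
    split_ifs with hl
    · simp
    · rw [Finsupp.smul_apply, Finsupp.finsetSum_apply, Finset.sum_eq_zero, smul_zero]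
      intro i hi
      have hlen := List.length_eraseIdx_of_lt (Finset.mem_range.1 hi)
      have hne : l.eraseIdx i ≠ [] := List.length_pos_iff.1 (by omega)
      rw [Finsupp.smul_apply, Finsupp.single_eq_of_ne hne.symm, smul_zero]

open Classical in
theorem pathDifferential_single_apply {l' : List V} (hl' : l' ≠ []) (l : List V) :
    pathDifferential V R (Finsupp.single l 1) l' =
      ∑ i ∈ Finset.range l.length with l.eraseIdx i = l', (-1) ^ i := by
  have hlen (i : ℕ) (hi : i < l.length) (he : l.eraseIdx i = l') : ¬ l.length ≤ 1 := by
    have := List.length_eraseIdx_of_lt hi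
    have := List.length_pos_iff.2 (he ▸ hl')
    omega
  rw [pathDifferential, Finsupp.linearCombination_single, one_smul, Finset.sum_filter]
  split_ifs with h1
  · refine (Finset.sum_eq_zero fun i hi => if_neg fun he => ?_).symm
    exact hlen i (Finset.mem_range.1 hi) he h1
  · simp [Finsupp.finsetSum_apply, Finsupp.single_apply]

theorem length_of_pathDifferential_apply_ne_zero (hx : x ∈ allowedChains G R n) {l : List V}
    (hl : pathDifferential V R x l ≠ 0) : l ≠ [] ∧ (l.length : ℤ) = n := by
  classical
  have hne : l ≠ [] := by
    rintro rfl
    exact hl (pathDifferential_apply_nil x)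
  refine ⟨hne, by_contra fun hlen => hl ?_⟩
  refine eqOn_allowedChains (f := Finsupp.lapply l ∘ₗ pathDifferential V R) (g := 0) ?_ hx
  intro l' hl'
  rw [LinearMap.comp_apply, Finsupp.lapply_apply, pathDifferential_single_apply hne,
    LinearMap.zero_apply, Finset.sum_eq_zero]
  intro i hi
  obtain ⟨hrange, rfl⟩ := Finset.mem_filter.1 hi
  have := List.length_eraseIdx_of_lt (Finset.mem_range.1 hrange)
  have := hl'.2.1
  have := List.length_pos_iff.2 hne
  omega

theorem IsBroken.pathDifferential_apply (h : IsBroken G Side.upper α β)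
    (hx : x ∈ allowedChains G R n) :
    pathDifferential V R x (α ++ β) = (-1) ^ α.length * bridgeSum R Side.upper α β x := by
  classical
  refine eqOn_allowedChains (f := Finsupp.lapply (α ++ β) ∘ₗ pathDifferential V R)
    (g := (-1 : R) ^ α.length • bridgeSum R Side.upper α β) ?_ hx
  rintro l ⟨-, -, hl⟩
  rw [LinearMap.comp_apply, Finsupp.lapply_apply, LinearMap.smul_apply, smul_eq_mul,
    pathDifferential_single_apply (List.append_ne_nil_of_left_ne_nil h.left_ne_nil β),
    Finset.filter_congr fun i hi => h.eraseIdx_eq_iff hl (Finset.mem_range.1 hi)]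
  by_cases hw : ∃ w, l = α ++ w :: β
  · have hfilter : {i ∈ Finset.range l.length | i = α.length ∧ ∃ w, l = α ++ w :: β} =
        {α.length} := by
      obtain ⟨w, rfl⟩ := hw
      ext i
      simp +contextual
    obtain ⟨w, rfl⟩ := hw
    rw [hfilter, Finset.sum_singleton]
    exact (mul_one _).symm.trans
      (congrArg _ (bridgeSum_single_bridge Side.upper α β w (1 : R)).symm)
  · rw [bridgeSum_single_of_forall_ne (fun w hl' => hw ⟨w, hl'⟩), mul_zero]
    simp [hw]

theorem mem_pathChains_iff_pathDifferential :
    x ∈ pathChains G R n ↔ x ∈ allowedChains G R n ∧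
      ∀ l, pathDifferential V R x l ≠ 0 → IsAllowed G (n - 1) l ∨ ¬ l.IsChain (· ≠ ·) := by
  rw [pathChains, Submodule.mem_inf, Submodule.comap_comp, Submodule.comap_map_mkQ,
    Submodule.mem_comap, irregular, allowedChains, allowedChains, ← Finsupp.supported_union,
    Finsupp.mem_supported R (s := _ ∪ _)]
  simp only [Set.subset_def, Finset.mem_coe, Finsupp.mem_support_iff, Set.mem_union,
    Set.mem_ofPred_eq, or_comm]

theorem mem_allowedChains_of_mem_pathChains (hx : x ∈ pathChains G R n) :
    x ∈ allowedChains G R n :=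
  hx.1

theorem bridgeSum_eq_zero_of_mem_pathChains (hG : ∀ v, ¬ G.Adj v v) (hx : x ∈ pathChains G R n)
    (h : IsBroken G Side.upper α β) : bridgeSum R Side.upper α β x = 0 := by
  rw [mem_pathChains_iff_pathDifferential] at hx
  by_cases hreg : (α ++ β).IsChain (· ≠ ·)
  · have hzero : pathDifferential V R x (α ++ β) = 0 := by
      by_contra hne
      rcases hx.2 _ hne with h' | h'
      · exact h.not_isChain h'.2.2
      · exact h' hreg
    rw [h.pathDifferential_apply hx.1] at hzero
    rcases neg_one_pow_eq_or R α.length with h1 | h1 <;> simpa [h1] using hzero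
  · refine bridgeSum_eq_zero fun w => by_contra fun hne => hreg ?_
    have hchain : (α ++ w :: β).IsChain G.Adj := (mem_allowedChains.1 hx.1 _ hne).2.2
    exact h.isChain_ne_append (hchain.imp fun a b hab => by rintro rfl; exact hG _ hab)

theorem mem_pathChains_of_bridgeSum_eq_zero (hx : x ∈ allowedChains G R n)
    (h : ∀ α β, IsBroken G Side.upper α β → bridgeSum R Side.upper α β x = 0) :
    x ∈ pathChains G R n := by
  refine mem_pathChains_iff_pathDifferential.2 ⟨hx, fun l hl => ?_⟩
  by_contra! hne
  obtain ⟨hnil, hlen⟩ := length_of_pathDifferential_apply_ne_zero hx hl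
  have hchain : ¬ l.IsChain G.Adj := fun hc => hne.1 ⟨hnil, by omega, hc⟩
  obtain ⟨α, β, rfl, hb⟩ := exists_isBroken_of_not_isChain hchain hne.2
  exact hl (by rw [hb.pathDifferential_apply hx, h α β hb, mul_zero])

theorem mem_pathChains_iff_bridgeSum (hG : ∀ v, ¬ G.Adj v v) (s : Side) :
    x ∈ pathChains G R n ↔ x ∈ allowedChains G R n ∧
      ∀ α β, IsBroken G s α β → bridgeSum R s α β x = 0 := by
  have hupper : x ∈ pathChains G R n ↔ x ∈ allowedChains G R n ∧
      ∀ α β, IsBroken G Side.upper α β → bridgeSum R Side.upper α β x = 0 :=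
    ⟨fun hx => ⟨hx.1, fun _ _ => bridgeSum_eq_zero_of_mem_pathChains hG hx⟩,
      fun hx => mem_pathChains_of_bridgeSum_eq_zero hx.1 hx.2⟩
  cases s
  · exact hupper
  · rw [hupper, forall_comm]
    simp only [isBroken_lower]
    rfl

end BridgeSum

/-! ### Extensions and faces -/

section Extension

variable {V : Type*} {G : Digraph V} {R : Type*} [CommRing R] {s : Side} {n : ℤ}
  {u v : V} {x y : Chain V R}

theorem mem_endSet : v ∈ endSet s x ↔ ∃ l, x l ≠ 0 ∧ s.last? l = some v := by
  cases s <;> simp [endSet, Side.last?]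

theorem endSet_sum_subset {ι : Type*} (I : Finset ι) (x : ι → Chain V R) :
    endSet s (∑ i ∈ I, x i) ⊆ ⋃ i, endSet s (x i) := by
  intro w hw
  obtain ⟨l, hl, hlw⟩ := mem_endSet.1 hw
  rw [Finsupp.finsetSum_apply] at hl
  obtain ⟨i, -, hi⟩ := Finset.exists_ne_zero_of_sum_ne_zero hl
  exact Set.mem_iUnion.2 ⟨i, mem_endSet.2 ⟨l, hi, hlw⟩⟩

/-- Delete the vertex `v` from the paths with end `v`, and drop the other paths. -/
noncomputable def strip (R : Type*) [CommRing R] (s : Side) (v : V) : Chain V R →ₗ[R] Chain V R :=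
  Finsupp.lcomapDomain (s.snoc · v) fun _ _ h => (s.snoc_inj.1 h).1

theorem strip_apply (v : V) (x : Chain V R) (l : List V) : strip R s v x l = x (s.snoc l v) :=
  rfl

theorem ext_strip (s : Side) (hnil : x [] = y []) (h : ∀ v, strip R s v x = strip R s v y) :
    x = y := by
  ext l
  obtain rfl | ⟨l', v, rfl⟩ := s.eq_nil_or_eq_snoc l
  · exact hnil
  · exact DFunLike.congr_fun (h v) l'

theorem bridgeSum_snoc (α β : List V) (v : V) (x : Chain V R) :
    bridgeSum R s α (s.snoc β v) x = bridgeSum R s α β (strip R s v x) :=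
  bridgeSum_congr fun w => by rw [strip_apply, s.bridge_snoc]

open Classical in
theorem extension_single (v : V) (l : List V) (c : R) :
    extension G s v (Finsupp.single l c) =
      if (s.snoc l v).IsChain G.Adj then Finsupp.single (s.snoc l v) c else 0 := by
  cases s <;> simp [extension, Side.snoc] <;> congr

theorem extension_apply_nil (v : V) (y : Chain V R) : extension G s v y [] = 0 := by
  induction y using Finsupp.induction_linear with
  | zero => simp
  | add y z hy hz => rw [map_add, Finsupp.add_apply, hy, hz, add_zero]
  | single l c =>
    rw [extension_single]
    split_ifs
    · exact Finsupp.single_eq_of_ne (s.snoc_ne_nil l v).symm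
    · rfl

open Classical in
theorem extension_apply_snoc (v w : V) (y : Chain V R) (l : List V) :
    extension G s v y (s.snoc l w) =
      if w = v ∧ (s.snoc l v).IsChain G.Adj then y l else 0 := by
  induction y using Finsupp.induction_linear with
  | zero => simp
  | add y z hy hz => rw [map_add, Finsupp.add_apply, hy, hz]; split_ifs <;> simp
  | single l' c =>
    rw [extension_single]
    rcases eq_or_ne l' l with rfl | hl
    · split_ifs <;> simp_all [s.snoc_inj]
    · rw [Finsupp.single_eq_of_ne hl.symm, ite_self]
      split_ifs <;> simp [s.snoc_inj, hl]

theorem strip_extension_of_ne (h : u ≠ v) (y : Chain V R) :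
    strip R s u (extension G s v y) = 0 := by
  classical
  ext l
  rw [strip_apply, extension_apply_snoc, if_neg fun h' => h h'.1, Finsupp.zero_apply]

theorem strip_extension_self (h : ∀ l, y l ≠ 0 → (s.snoc l v).IsChain G.Adj) :
    strip R s v (extension G s v y) = y := by
  classical
  ext l
  rw [strip_apply, extension_apply_snoc]
  split_ifs with hl
  · rfl
  · by_contra hne
    exact hl ⟨rfl, h l (Ne.symm hne)⟩

theorem endSet_extension (h : extension G s v y ≠ 0) : endSet s (extension G s v y) = {v} := by
  classical
  have hlast : ∀ l, extension G s v y l ≠ 0 → s.last? l = some v := by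
    intro l hl
    obtain rfl | ⟨l, w, rfl⟩ := s.eq_nil_or_eq_snoc l
    · exact absurd (extension_apply_nil v y) hl
    · rw [extension_apply_snoc] at hl
      rw [s.last?_snoc, (ite_ne_right_iff.1 hl).1.1]
  obtain ⟨l, hl⟩ := Finsupp.ne_iff.1 h
  refine Set.eq_singleton_iff_unique_mem.2 ⟨mem_endSet.2 ⟨l, hl, hlast l hl⟩, fun w hw => ?_⟩
  obtain ⟨l', hl', hw⟩ := mem_endSet.1 hw
  exact Option.some_injective _ (hw.symm.trans (hlast l' hl'))

open Classical in
theorem faceMap_single_snoc (u : V) (l : List V) (v : V) (c : R) :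
    faceMap s u (Finsupp.single (s.snoc l v) c) =
      if s.last? l = some u then Finsupp.single l c else 0 := by
  cases s
  · by_cases hu : l.getLast? = some u <;> simp [faceMap, Side.snoc, Side.last?, hu]
  · by_cases hu : l.head? = some u <;> simp [faceMap, Side.snoc, Side.last?, hu, -List.head?_tail]

theorem faceMap_single_nil (u : V) (c : R) : faceMap s u (Finsupp.single [] c) = 0 := by
  cases s <;> simp [faceMap]

open Classical in
theorem faceMap_apply (u : V) (x : Chain V R) (α : List V) :
    faceMap s u x α = if s.last? α = some u then bridgeSum R s α [] x else 0 := by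
  induction x using Finsupp.induction_linear with
  | zero => simp
  | add y z hy hz => rw [map_add, Finsupp.add_apply, hy, hz, map_add]; split_ifs <;> simp
  | single l c =>
    by_cases hl : ∃ w, l = s.bridge α [] w
    · obtain ⟨w, rfl⟩ := hl
      rw [bridgeSum_single_bridge, s.bridge_nil, faceMap_single_snoc]
      split_ifs <;> simp
    · rw [bridgeSum_single_of_forall_ne (not_exists.1 hl), ite_self]
      obtain rfl | ⟨l, v, rfl⟩ := s.eq_nil_or_eq_snoc l
      · rw [faceMap_single_nil, Finsupp.zero_apply]
      · have hα : α ≠ l := by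
          rintro rfl
          exact hl ⟨v, (s.bridge_nil α v).symm⟩
        rw [faceMap_single_snoc]
        split_ifs <;> simp [hα]

theorem faceMap_eq_zero_iff :
    faceMap s u x = 0 ↔ ∀ α, s.last? α = some u → bridgeSum R s α [] x = 0 := by
  classical
  simp [Finsupp.ext_iff, faceMap_apply]

theorem faceMap_eq_zero_of_nonpos (hn : n ≤ 0) (hx : x ∈ allowedChains G R n) :
    faceMap s u x = 0 := by
  classical
  refine eqOn_allowedChains (g := 0) (fun l hl => ?_) hx
  obtain rfl | ⟨l, v, rfl⟩ := s.eq_nil_or_eq_snoc l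
  · exact absurd rfl hl.1
  · have hlen := hl.2.1
    rw [s.length_snoc] at hlen
    obtain rfl : l = [] := List.length_eq_zero_iff.1 (by omega)
    simp [faceMap_single_snoc, s.last?_nil]

theorem mem_allowedChains_iff_strip (hn : 1 ≤ n) :
    x ∈ allowedChains G R n ↔ x [] = 0 ∧ ∀ v, strip R s v x ∈ allowedChains G R (n - 1) ∧
      endSet s (strip R s v x) ⊆ {w | Joins G s w v} := by
  simp only [mem_allowedChains, strip_apply, Set.subset_def, mem_endSet, Set.mem_ofPred_eq]
  constructor
  · intro hx
    refine ⟨by_contra fun h => (hx [] h).1 rfl, fun v => ⟨fun l hl => ?_, ?_⟩⟩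
    · exact ((isAllowed_snoc hn).1 (hx _ hl)).1
    · rintro w ⟨l, hl, hw⟩
      exact ((isAllowed_snoc hn).1 (hx _ hl)).2 w hw
  · rintro ⟨hnil, hx⟩ l hl
    obtain rfl | ⟨l, v, rfl⟩ := s.eq_nil_or_eq_snoc l
    · exact absurd hnil hl
    · exact (isAllowed_snoc hn).2 ⟨(hx v).1 l hl, fun w hw => (hx v).2 w ⟨l, hl, hw⟩⟩

theorem forall_isBroken_iff_strip :
    (∀ α β, IsBroken G s α β → bridgeSum R s α β x = 0) ↔
      ∀ v, (∀ α β, IsBroken G s α β → bridgeSum R s α β (strip R s v x) = 0) ∧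
        ∀ u, u ≠ v → ¬ Joins G s u v → faceMap s u (strip R s v x) = 0 := by
  constructor
  · intro h v
    refine ⟨fun α β hb => ?_, fun u huv hj => faceMap_eq_zero_iff.2 fun α hα => ?_⟩
    · rw [← bridgeSum_snoc, h _ _ ((isBroken_snoc hb.right_ne_nil v).2 hb)]
    · rw [← bridgeSum_snoc, h _ _ (isBroken_snoc_nil.2 ⟨u, hα, huv, hj⟩)]
  · intro h α β hb
    obtain rfl | ⟨β, v, rfl⟩ := s.eq_nil_or_eq_snoc β
    · exact absurd rfl hb.right_ne_nil
    · rw [bridgeSum_snoc]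
      rcases eq_or_ne β [] with rfl | hβ
      · obtain ⟨u, hα, huv, hj⟩ := isBroken_snoc_nil.1 hb
        exact faceMap_eq_zero_iff.1 ((h v).2 u huv hj) α hα
      · exact (h v).1 α β ((isBroken_snoc hβ v).1 hb)

/-- Appending `v` to the paths of `y` gives a path chain one dimension higher: every end of `y` is
joined to `v`, and the faces of `y` at the vertices not joined to `v` vanish. -/
structure IsExtendable (G : Digraph V) (s : Side) (n : ℤ) (y : Chain V R) (v : V) : Prop where
  mem_pathChains : y ∈ pathChains G R n
  endSet_subset : endSet s y ⊆ {w | Joins G s w v}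
  faceMap_eq_zero : ∀ u, u ≠ v → ¬ Joins G s u v → faceMap s u y = 0

theorem isExtendable_zero : IsExtendable G s n (0 : Chain V R) v where
  mem_pathChains := zero_mem _
  endSet_subset w hw := by simp [mem_endSet] at hw
  faceMap_eq_zero _ _ _ := map_zero _

theorem IsExtendable.isChain_snoc (hy : IsExtendable G s n y v) (l : List V) (hl : y l ≠ 0) :
    (s.snoc l v).IsChain G.Adj :=
  (s.isChain_snoc G l v).2
    ⟨(mem_allowedChains.1 (mem_allowedChains_of_mem_pathChains hy.mem_pathChains) l hl).2.2,
      fun _ hw => hy.endSet_subset (mem_endSet.2 ⟨l, hl, hw⟩)⟩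

theorem IsExtendable.strip_extension (hy : IsExtendable G s n y v) :
    strip R s v (extension G s v y) = y :=
  strip_extension_self hy.isChain_snoc

theorem mem_pathChains_iff_strip (hG : ∀ v, ¬ G.Adj v v) (hn : 1 ≤ n) :
    x ∈ pathChains G R n ↔
      x [] = 0 ∧ ∀ v, IsExtendable G s (n - 1) (strip R s v x) v := by
  rw [mem_pathChains_iff_bridgeSum hG s, mem_allowedChains_iff_strip (s := s) hn, and_assoc,
    forall_isBroken_iff_strip, ← forall_and]
  refine and_congr_right fun _ => forall_congr' fun v => ⟨fun h => ?_, fun h => ?_⟩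
  · exact ⟨(mem_pathChains_iff_bridgeSum hG s).2 ⟨h.1.1, h.2.1⟩, h.1.2, h.2.2⟩
  · have hmem := (mem_pathChains_iff_bridgeSum hG s).1 h.mem_pathChains
    exact ⟨⟨hmem.1, h.endSet_subset⟩, hmem.2, h.faceMap_eq_zero⟩

theorem IsExtendable.extension_mem_pathChains (hG : ∀ v, ¬ G.Adj v v) (hn : 1 ≤ n)
    (hy : IsExtendable G s (n - 1) y v) : extension G s v y ∈ pathChains G R n := by
  refine (mem_pathChains_iff_strip (s := s) hG hn).2 ⟨extension_apply_nil v y, fun w => ?_⟩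
  rcases eq_or_ne w v with rfl | hw
  · rwa [hy.strip_extension]
  · rw [strip_extension_of_ne hw]
    exact isExtendable_zero

theorem exists_sum_extension_strip_eq (s : Side) (hx : x ∈ allowedChains G R n) :
    ∃ S : Finset V, ∑ v ∈ S, extension G s v (strip R s v x) = x := by
  classical
  refine ⟨x.support.biUnion fun l => (s.last? l).toFinset, ext_strip s ?_ fun w => ?_⟩
  · rw [Finsupp.finsetSum_apply, Finset.sum_eq_zero fun v _ => extension_apply_nil v _]
    by_contra hne
    exact (mem_allowedChains.1 hx _ (Ne.symm hne)).1 rfl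
  · have hself : strip R s w (extension G s w (strip R s w x)) = strip R s w x :=
      strip_extension_self fun l hl => (mem_allowedChains.1 hx _ hl).2.2
    rw [map_sum, Finset.sum_eq_single w (fun v _ hv => strip_extension_of_ne hv.symm _), hself]
    intro hw
    rw [hself]
    ext l
    by_contra hne
    refine hw (Finset.mem_biUnion.2 ⟨s.snoc l w, Finsupp.mem_support_iff.2 hne, ?_⟩)
    simp [s.last?_snoc]

open Classical in
/-- The part of a chain supported on the paths with end in `W`. -/
noncomputable def restrictEnd (R : Type*) [CommRing R] (s : Side) (W : Set V) :
    Chain V R →ₗ[R] Chain V R :=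
  Submodule.subtype _ ∘ₗ Finsupp.restrictDom R R {l : List V | ∃ v ∈ W, s.last? l = some v}

open Classical in
theorem restrictEnd_apply (W : Set V) (x : Chain V R) (l : List V) :
    restrictEnd R s W x l = if ∃ v ∈ W, s.last? l = some v then x l else 0 := by
  simp [restrictEnd, Finsupp.restrictDom_apply, Finsupp.filter_apply]

theorem restrictEnd_eq_self {W : Set V} (hnil : x [] = 0) (hx : endSet s x ⊆ W) :
    restrictEnd R s W x = x := by
  classical
  ext l
  rw [restrictEnd_apply, ite_eq_left_iff]
  intro hl
  obtain rfl | ⟨l, v, rfl⟩ := s.eq_nil_or_eq_snoc l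
  · exact hnil.symm
  · by_contra hne
    exact hl ⟨v, hx (mem_endSet.2 ⟨_, Ne.symm hne, s.last?_snoc l v⟩), s.last?_snoc l v⟩

theorem restrictEnd_eq_zero {W : Set V} (hx : Disjoint (endSet s x) W) :
    restrictEnd R s W x = 0 := by
  classical
  ext l
  rw [restrictEnd_apply, Finsupp.zero_apply, ite_eq_right_iff]
  rintro ⟨v, hv, hl⟩
  by_contra hne
  exact hx.notMem_of_mem_right hv (mem_endSet.2 ⟨l, hne, hl⟩)

theorem restrictEnd_mem_pathChains (hG : ∀ v, ¬ G.Adj v v) (W : Set V)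
    (hx : x ∈ pathChains G R n) : restrictEnd R s W x ∈ pathChains G R n := by
  classical
  rw [mem_pathChains_iff_bridgeSum hG s] at hx ⊢
  refine ⟨mem_allowedChains.2 fun l hl => mem_allowedChains.1 hx.1 l ?_, fun α β hb => ?_⟩
  · rw [restrictEnd_apply] at hl
    exact (ite_ne_right_iff.1 hl).2
  · have happ (w : V) : restrictEnd R s W x (s.bridge α β w) =
        if ∃ v ∈ W, s.last? β = some v then x (s.bridge α β w) else 0 := by
      rw [restrictEnd_apply, s.last?_bridge α hb.right_ne_nil]
    by_cases hW : ∃ v ∈ W, s.last? β = some v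
    · rw [← hx.2 α β hb]
      exact bridgeSum_congr fun w => by rw [happ, if_pos hW]
    · exact bridgeSum_eq_zero fun w => by rw [happ, if_neg hW]

theorem mem_span_endSet_subset {E : Set (Chain V R)} {W : Set V} (hnil : ∀ e ∈ E, e [] = 0)
    (hE : ∀ e ∈ E, (endSet s e).Subsingleton) (hy : y ∈ Submodule.span R E)
    (hW : endSet s y ⊆ W) : y ∈ Submodule.span R {e ∈ E | endSet s e ⊆ W} := by
  have hnil' : y [] = 0 :=
    LinearMap.eqOn_span (f := Finsupp.lapply []) (g := 0) (fun e he => hnil e he) hy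
  have hmem : restrictEnd R s W y ∈ (Submodule.span R E).map (restrictEnd R s W) :=
    Submodule.mem_map_of_mem hy
  rw [restrictEnd_eq_self hnil' hW, Submodule.map_span] at hmem
  refine Submodule.span_le.2 ?_ hmem
  rintro _ ⟨e, he, rfl⟩
  by_cases heW : endSet s e ⊆ W
  · rw [restrictEnd_eq_self (hnil e he) heW]
    exact Submodule.subset_span ⟨he, heW⟩
  · obtain ⟨w, hw, hwW⟩ := Set.not_subset.1 heW
    rw [restrictEnd_eq_zero]
    · exact zero_mem _
    · exact Set.disjoint_left.2 fun w' hw' hW' => hwW (hE e he hw' hw ▸ hW')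

theorem IsExtendable.faceMap_extension (hy : IsExtendable G s n y v) :
    faceMap s u (extension G s v y) = restrictEnd R s {u} y := by
  classical
  ext α
  rw [faceMap_apply, restrictEnd_apply]
  simp only [Set.mem_singleton_iff, exists_eq_left]
  rw [bridgeSum_eq_apply v, s.bridge_nil, ← strip_apply, hy.strip_extension]
  intro w hw
  rw [s.bridge_nil, ← strip_apply, strip_extension_of_ne hw, Finsupp.zero_apply]

theorem faceMap_mem_pathChains (hG : ∀ v, ¬ G.Adj v v) (hx : x ∈ pathChains G R n) (u : V) :
    faceMap s u x ∈ pathChains G R (n - 1) := by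
  have hxa := mem_allowedChains_of_mem_pathChains hx
  rcases le_or_gt n 0 with hn | hn
  · rw [faceMap_eq_zero_of_nonpos hn hxa]
    exact zero_mem _
  · obtain ⟨S, hS⟩ := exists_sum_extension_strip_eq s hxa
    have hstrip := ((mem_pathChains_iff_strip (s := s) hG hn).1 hx).2
    rw [← hS, map_sum]
    refine Submodule.sum_mem _ fun v _ => ?_
    rw [(hstrip v).faceMap_extension]
    exact restrictEnd_mem_pathChains hG _ (hstrip v).mem_pathChains

theorem pathChains_of_neg (hn : n < 0) : pathChains G R n = ⊥ := by
  refine (Submodule.eq_bot_iff _).2 fun x hx => Finsupp.ext fun l => by_contra fun hne => ?_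
  obtain ⟨hnil, hlen, -⟩ := mem_allowedChains.1 (mem_allowedChains_of_mem_pathChains hx) l hne
  have := List.length_pos_iff.2 hnil
  omega

theorem single_mem_pathChains (v : V) : Finsupp.single [v] (1 : R) ∈ pathChains G R 0 := by
  refine mem_pathChains_of_bridgeSum_eq_zero
    (Finsupp.single_mem_supported R 1 (show IsAllowed G 0 [v] by simp [IsAllowed])) ?_
  refine fun α β hb => bridgeSum_single_of_forall_ne (fun w hw => ?_) 1
  simp [Side.bridge, List.singleton_eq_append_iff, hb.left_ne_nil] at hw

theorem span_inductiveElements_zero :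
    Submodule.span R (inductiveElements G R s 0) = pathChains G R 0 := by
  refine le_antisymm (Submodule.span_le.2 ?_) fun x hx => ?_
  · rintro x ⟨v, rfl | rfl⟩
    · exact single_mem_pathChains v
    · exact neg_mem (single_mem_pathChains v)
  · have hspan := mem_allowedChains_of_mem_pathChains hx
    rw [allowedChains, Finsupp.supported_eq_span_single] at hspan
    refine Submodule.span_mono ?_ hspan
    rintro _ ⟨l, ⟨-, hlen, -⟩, rfl⟩
    obtain ⟨v, rfl⟩ := List.length_eq_one_iff.1 (show l.length = 1 by omega)
    exact ⟨v, .inl rfl⟩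

end Extension

/-! ### Zero-sum-free decompositions and partitions into fibers -/

section Decomposition

theorem exists_multiset_sum_eq_of_mem_span {p : ℕ} [NeZero p] {M : Type*} [AddCommGroup M]
    [Module (ZMod p) M] {B : Set M} {y : M} (hy : y ∈ Submodule.span (ZMod p) B) :
    ∃ t : Multiset M, (∀ a ∈ t, a ∈ B) ∧ t.sum = y := by
  induction hy using Submodule.span_induction with
  | mem a ha => exact ⟨{a}, by simpa using ha, by simp⟩
  | zero => exact ⟨0, by simp, by simp⟩
  | add a b _ _ ha hb =>
    obtain ⟨t, ht, rfl⟩ := ha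
    obtain ⟨t', ht', rfl⟩ := hb
    refine ⟨t + t', fun c hc => ?_, Multiset.sum_add _ _⟩
    exact (Multiset.mem_add.1 hc).elim (ht c) (ht' c)
  | smul c a _ ha =>
    obtain ⟨t, ht, rfl⟩ := ha
    refine ⟨c.val • t, fun b hb => ht b (Multiset.mem_of_mem_nsmul hb), ?_⟩
    rw [Multiset.sum_nsmul, ← Nat.cast_smul_eq_nsmul (ZMod p), ZMod.natCast_zmod_val]

theorem exists_le_sum_eq_forall_le_eq_zero {M : Type*} [AddCommMonoid M] (t : Multiset M) :
    ∃ t' ≤ t, t'.sum = t.sum ∧ ∀ r ≤ t', r.sum = 0 → r = 0 := by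
  induction t using Multiset.strongInductionOn with
  | ih t ih =>
    by_cases h : ∀ r ≤ t, r.sum = 0 → r = 0
    · exact ⟨t, le_rfl, rfl, h⟩
    · push Not at h
      obtain ⟨r, hr, hr0, hne⟩ := h
      obtain ⟨q, rfl⟩ := Multiset.le_iff_exists_add.1 hr
      obtain ⟨t', ht', hsum, hfree⟩ := ih q (lt_add_of_pos_left q (pos_iff_ne_zero.2 hne))
      refine ⟨t', ht'.trans (Multiset.le_add_left q r), ?_, hfree⟩
      rw [hsum, Multiset.sum_add, hr0, zero_add]

theorem exists_fin_sum_eq_of_mem_span {p : ℕ} [NeZero p] {M : Type*} [AddCommGroup M]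
    [Module (ZMod p) M] {B : Set M} {y : M} (hy : y ∈ Submodule.span (ZMod p) B) :
    ∃ (m : ℕ) (f : Fin m → M), (∀ i, f i ∈ B) ∧ ∑ i, f i = y ∧
      ∀ S : Finset (Fin m), S.Nonempty → ∑ i ∈ S, f i ≠ 0 := by
  obtain ⟨t₀, ht₀, rfl⟩ := exists_multiset_sum_eq_of_mem_span hy
  obtain ⟨t, ht, hsum, hfree⟩ := exists_le_sum_eq_forall_le_eq_zero t₀
  have hmap : Finset.univ.val.map t.toList.get = t := by
    rw [Fin.univ_val_map, List.ofFn_get, Multiset.coe_toList]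
  refine ⟨t.toList.length, t.toList.get, fun i => ?_, ?_, fun S hS h0 => ?_⟩
  · exact ht₀ _ (Multiset.mem_of_le ht (Multiset.mem_toList.1 (List.get_mem _ i)))
  · exact (congrArg Multiset.sum hmap).trans hsum
  · have hle : S.val.map t.toList.get ≤ t :=
      (Multiset.map_le_map (Finset.val_le_iff.2 S.subset_univ)).trans_eq hmap
    exact hS.ne_empty (Finset.val_eq_zero.1 (Multiset.map_eq_zero.1 (hfree _ hle h0)))

theorem exists_finpartition_card_eq {α : Type*} [DecidableEq α] {p : ℕ} {A : Finset α}
    (h : p ∣ A.card) : ∃ P : Finpartition A, ∀ T ∈ P.parts, T.card = p := by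
  obtain ⟨d, hd⟩ := h
  have hcard : d * p + 0 * (p + 1) = A.card := by rw [hd]; ring
  refine ⟨(⊤ : Finpartition A).equitabilise hcard, fun T hT => ?_⟩
  refine (Finpartition.card_eq_of_mem_parts_equitabilise hT).resolve_right fun hbig => ?_
  have hnone := Finset.card_eq_zero.1
    (Finpartition.card_filter_equitabilise_big (⊤ : Finpartition A) hcard)
  exact (Finset.filter_eq_empty_iff.1 hnone) hT hbig

theorem exists_finpartition_fibers {α M : Type*} [DecidableEq α] [DecidableEq M] {f : α → M}
    {p : ℕ} {A : Finset α} (h : ∀ b, p ∣ {a ∈ A | f a = b}.card) :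
    ∃ P : Finpartition A, ∀ T ∈ P.parts, T.card = p ∧ ∀ a ∈ T, ∀ b ∈ T, f a = f b := by
  let fibers : Finpartition A := Finpartition.ofSetSetoid (Setoid.ker f) A
  have hfibers : ∀ C ∈ fibers.parts, ∃ b, C = {a ∈ A | f a = b} := by
    intro C hC
    obtain ⟨a, -, rfl⟩ := Finset.mem_image.1 hC
    exact ⟨f a, Finset.filter_congr fun b _ => eq_comm⟩
  have hcut : ∀ C ∈ fibers.parts, ∃ Q : Finpartition C, ∀ T ∈ Q.parts, T.card = p := by
    intro C hC
    obtain ⟨b, rfl⟩ := hfibers C hC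
    exact exists_finpartition_card_eq (h b)
  choose Q hQ using hcut
  refine ⟨fibers.bind Q, fun T hT => ?_⟩
  obtain ⟨C, hC, hT⟩ := Finpartition.mem_bind.1 hT
  refine ⟨hQ C hC T hT, fun a ha b hb => ?_⟩
  have hTC := (Q C hC).le hT
  obtain ⟨c, rfl⟩ := hfibers C hC
  rw [(Finset.mem_filter.1 (hTC ha)).2, (Finset.mem_filter.1 (hTC hb)).2]

theorem dvd_card_fiber {p : ℕ} {M : Type*} [AddCommGroup M] [DecidableEq M]
    [Module (ZMod p) M] {B : Set M} (hB : LinearIndepOn (ZMod p) id B) {α : Type*} {A : Finset α}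
    {f : α → M} (hf : ∀ a ∈ A, f a ∈ B) (h0 : ∑ a ∈ A, f a = 0) (b : M) :
    p ∣ {a ∈ A | f a = b}.card := by
  by_cases hb : b ∈ A.image f
  · rw [← ZMod.natCast_eq_zero_iff]
    refine linearIndepOn_iff'.1 hB (A.image f) (fun b => ({a ∈ A | f a = b}.card : ZMod p)) ?_ ?_
      b hb
    · intro c hc
      obtain ⟨a, ha, rfl⟩ := Finset.mem_image.1 hc
      exact hf a ha
    · rw [← h0, Finset.sum_comp (fun c : M => c) f]
      exact Finset.sum_congr rfl fun c _ => Nat.cast_smul_eq_nsmul _ _ _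
  · rw [Finset.filter_false_of_mem, Finset.card_empty]
    · exact dvd_zero p
    · rintro a ha rfl
      exact hb (Finset.mem_image_of_mem f ha)

theorem exists_basis_subset_of_span_eq {K M : Type*} [Field K] [AddCommGroup M] [Module K M]
    {t : Set M} {W : Submodule K M} (h : Submodule.span K t = W) :
    ∃ B ⊆ t, ∃ b : Module.Basis B K W, ∀ x : B, (b x : M) = x := by
  obtain ⟨B, hBt, hspan, hB⟩ := exists_linearIndependent K t
  have hW : Submodule.span K (Set.range ((↑) : B → M)) = W := by
    rw [Subtype.range_coe, hspan, h]
  refine ⟨B, hBt, (Module.Basis.span hB).map (LinearEquiv.ofEq _ _ hW), fun x => ?_⟩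
  simp [Module.Basis.span_apply]

end Decomposition

/-! ### Face multihypergraphs and mutations -/

section FaceMultihypergraph

variable {V : Type*} {G : Digraph V} {R : Type*} [CommRing R] {s : Side} {n : ℤ}
  {D : FaceData G R s n}

/-- The summands, given by their `u` and their index pair, that appear in one of the labels. -/
def FaceData.slots (D : FaceData G R s n) (X : Set D.Label) : Set ((u : V) × D.Slot u) :=
  ⋃ e ∈ X, Sigma.mk e.1 '' e.2

namespace FaceData

theorem mem_slots {X : Set D.Label} {u : V} {a : D.Slot u} :
    ⟨u, a⟩ ∈ D.slots X ↔ ∃ S : Finset (D.Slot u), ⟨u, S⟩ ∈ X ∧ a ∈ S := by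
  simp only [slots, Set.mem_iUnion, Set.mem_image, exists_prop]
  constructor
  · rintro ⟨⟨u, S⟩, hS, a, ha, h⟩
    cases h
    exact ⟨S, hS, ha⟩
  · rintro ⟨S, hS, ha⟩
    exact ⟨⟨u, S⟩, hS, a, ha, rfl⟩

theorem slots_union (X Y : Set D.Label) : D.slots (X ∪ Y) = D.slots X ∪ D.slots Y :=
  Set.biUnion_union X Y _

theorem slots_pair {u : V} (S T : Finset (D.Slot u)) :
    D.slots {⟨u, S⟩, ⟨u, T⟩} = Sigma.mk u '' (S ∪ T) := by
  rw [slots, Set.biUnion_pair, Set.image_union]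

theorem slots_range {u : V} {ι : Type*} (S : ι → Finset (D.Slot u)) :
    D.slots (Set.range fun j => (⟨u, S j⟩ : D.Label)) = Sigma.mk u '' ⋃ j, S j := by
  rw [slots, Set.biUnion_range, Set.image_iUnion]

theorem slots_diff_union {X Y Z : Set D.Label} (hX : X ⊆ Z) (h : D.slots X = D.slots Y) :
    D.slots (Z \ X ∪ Y) = D.slots Z := by
  rw [slots_union, ← h, ← slots_union, Set.sdiff_union_of_subset hX]

theorem slots_range_pair {u : V} {t : ℕ} (a b : Fin t ↪ D.Slot u) :
    D.slots (Set.range fun j : Fin t => (⟨u, {a j, b j}⟩ : D.Label)) =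
      D.slots {⟨u, Finset.univ.map a⟩, ⟨u, Finset.univ.map b⟩} := by
  rw [slots_range, slots_pair]
  congr 1
  ext c
  simp only [Finset.coe_pair, Set.mem_iUnion, Set.mem_insert_iff, Set.mem_singleton_iff,
    exists_or, Finset.coe_map, Finset.coe_univ, Set.image_univ, Set.mem_union, Set.mem_range,
    eq_comm]

theorem sum_val (D : FaceData G R s n) (u : V) (I : Finset (Fin D.m)) :
    ∑ a ∈ I.sigma fun _ => Finset.univ, D.val (u := u) a = faceMap s u (∑ i ∈ I, D.x i) := by
  rw [Finset.sum_sigma, map_sum]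
  exact Finset.sum_congr rfl fun i _ => D.sum_part i u

theorem faceMap_ne_zero (D : FaceData G R s n) {u : V} (a : D.Slot u) :
    faceMap s u (D.x a.1) ≠ 0 := by
  rw [← D.sum_part a.1 u]
  exact D.no_zero_sum a.1 u _ ⟨a.2, Finset.mem_univ _⟩

theorem exists_ne_vertex_of_sum_val_eq_zero {u : V} {T : Finset (D.Slot u)} (hT : T.Nonempty)
    (h0 : ∑ a ∈ T, D.val a = 0) : ∃ a ∈ T, ∃ b ∈ T, a.1 ≠ b.1 := by
  by_contra! h
  obtain ⟨⟨i, k⟩, hk⟩ := hT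
  let K : Finset (Fin (D.count i u)) := {k | (⟨i, k⟩ : D.Slot u) ∈ T}
  have hmap : T = K.map (Function.Embedding.sigmaMk i) := by
    ext ⟨j, l⟩
    simp only [K, Finset.mem_map, Finset.mem_filter_univ, Function.Embedding.sigmaMk_apply]
    constructor
    · intro hl
      obtain rfl : i = j := h _ hk _ hl
      exact ⟨l, hl, rfl⟩
    · rintro ⟨l', hl', h'⟩
      rwa [← h']
  rw [hmap, Finset.sum_map] at h0
  exact D.no_zero_sum i u K ⟨k, (Finset.mem_filter_univ k).2 hk⟩ h0

end FaceData

namespace FaceMultihypergraph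

theorem nonempty_of_mem_edges (F : FaceMultihypergraph D) {e : D.Label} (he : e ∈ F.edges) :
    e.2.Nonempty := by
  rcases F.valid e he with ⟨a, b, h, -⟩ | h
  · rw [h]
    exact Finset.insert_nonempty _ _
  · exact Finset.card_pos.1 (by have := h.1; omega)

theorem sum_val_eq_zero (F : FaceMultihypergraph D) {e : D.Label} (he : e ∈ F.edges) :
    ∑ a ∈ e.2, D.val a = 0 := by
  rcases F.valid e he with ⟨a, b, h, hne, hv⟩ | h
  · rw [h, Finset.sum_pair (ne_of_apply_ne _ hne), hv, neg_add_cancel]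
  · exact h.2.2.2

theorem Mutation.slots_eq {F F' : FaceMultihypergraph D} (h : Mutation F F') :
    D.slots F'.edges = D.slots F.edges := by
  cases h with
  | edges u a b c d h₁ h₂ _ _ _ h =>
    rw [h]
    refine FaceData.slots_diff_union (Set.pair_subset h₁ h₂) ?_
    rw [FaceData.slots_pair, FaceData.slots_pair]
    congr 1
    ext
    simp only [Finset.coe_pair, Set.mem_union, Set.mem_insert_iff, Set.mem_singleton_iff]
    tauto
  | split u t _ a b h₁ h₂ _ h =>
    rw [h]
    exact FaceData.slots_diff_union (Set.pair_subset h₁ h₂) (FaceData.slots_range_pair a b).symm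
  | merge u t _ a b h₁ _ h =>
    rw [h]
    exact FaceData.slots_diff_union (Set.range_subset_iff.2 h₁) (FaceData.slots_range_pair a b)
  | redistribute u t _ S S' T T' h₁ h₂ _ _ _ _ _ _ hunion h =>
    rw [h]
    refine FaceData.slots_diff_union (Set.pair_subset h₁ h₂) ?_
    rw [FaceData.slots_pair, FaceData.slots_pair, ← Finset.coe_union, ← Finset.coe_union, hunion]

theorem slots_eq_of_eqvGen {F F' : FaceMultihypergraph D} (h : Relation.EqvGen Mutation F F') :
    D.slots F'.edges = D.slots F.edges := by
  induction h with
  | rel _ _ h => exact h.slots_eq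
  | refl => rfl
  | symm _ _ _ ih => exact ih.symm
  | trans _ _ _ _ _ ih ih' => exact ih'.trans ih

theorem complete_iff {F : FaceMultihypergraph D} {v : V} :
    F.Complete v ↔ D.slots F.edges = {a | a.1 ≠ v ∧ ¬ Joins G s a.1 v} := by
  constructor
  · rintro ⟨hproper, hcover⟩
    ext ⟨u, a⟩
    rw [FaceData.mem_slots]
    constructor
    · rintro ⟨S, hS, -⟩
      exact (hproper _ hS).symm
    · rintro ⟨huv, hj⟩
      exact hcover a.1 u (D.faceMap_ne_zero a) huv hj a.2
  · intro h
    refine ⟨fun e he => ?_, fun i u _ huv hj k => ?_⟩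
    · obtain ⟨a, ha⟩ := F.nonempty_of_mem_edges he
      have hmem : ⟨e.1, a⟩ ∈ D.slots F.edges := FaceData.mem_slots.2 ⟨e.2, he, ha⟩
      rw [h] at hmem
      exact hmem.symm
    · rw [← FaceData.mem_slots, h]
      exact ⟨huv, hj⟩

theorem complete_iff_of_eqvGen {F F' : FaceMultihypergraph D}
    (h : Relation.EqvGen Mutation F F') (v : V) : F'.Complete v ↔ F.Complete v := by
  rw [complete_iff, complete_iff, slots_eq_of_eqvGen h]

/-- A set of vertices that every hyperedge meeting it is contained in, that is, a union of
connected components. -/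
def IsLinkClosed (F : FaceMultihypergraph D) (I : Finset (Fin D.m)) : Prop :=
  ∀ i ∈ I, ∀ j, F.Linked i j → j ∈ I

theorem Linked.symm {F : FaceMultihypergraph D} {i j : Fin D.m} (h : F.Linked i j) :
    F.Linked j i :=
  let ⟨e, he, hi, hj⟩ := h
  ⟨e, he, hj, hi⟩

theorem IsLinkClosed.compl {F : FaceMultihypergraph D} {I : Finset (Fin D.m)}
    (hI : F.IsLinkClosed I) : F.IsLinkClosed Iᶜ := by
  intro i hi j hij
  rw [Finset.mem_compl] at hi ⊢
  exact fun hj => hi (hI j hj i hij.symm)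

theorem exists_isLinkClosed_of_not_connected {F : FaceMultihypergraph D} (h : ¬ F.Connected) :
    ∃ I : Finset (Fin D.m), I.Nonempty ∧ Iᶜ.Nonempty ∧ F.IsLinkClosed I := by
  classical
  obtain ⟨i, j, hij⟩ : ∃ i j, ¬ Relation.ReflTransGen F.Linked i j := by
    simpa only [Connected, not_forall] using h
  let component : Finset (Fin D.m) := {k | Relation.ReflTransGen F.Linked i k}
  refine ⟨component, ⟨i, ?_⟩, ⟨j, ?_⟩, fun k hk l hkl => ?_⟩
  · exact (Finset.mem_filter_univ i).2 .refl
  · rwa [Finset.mem_compl, Finset.mem_filter_univ]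
  · rw [Finset.mem_filter_univ] at hk ⊢
    exact hk.tail hkl

theorem Complete.faceMap_sum_eq_zero {F : FaceMultihypergraph D} {v : V} (hF : F.Complete v)
    {I : Finset (Fin D.m)} (hI : F.IsLinkClosed I) {u : V} (huv : u ≠ v)
    (hj : ¬ Joins G s u v) : faceMap s u (∑ i ∈ I, D.x i) = 0 := by
  classical
  let labels : Finset (Finset (D.Slot u)) :=
    {T | (⟨u, T⟩ : D.Label) ∈ F.edges ∧ ∀ a ∈ T, a.1 ∈ I}
  have hlabels {T} : T ∈ labels ↔ (⟨u, T⟩ : D.Label) ∈ F.edges ∧ ∀ a ∈ T, a.1 ∈ I :=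
    Finset.mem_filter_univ T
  have hunion : (I.sigma fun _ => Finset.univ : Finset (D.Slot u)) = labels.biUnion id := by
    ext a
    simp only [Finset.mem_sigma, Finset.mem_univ, and_true, Finset.mem_biUnion, hlabels, id]
    constructor
    · intro ha
      obtain ⟨S, hS, haS⟩ := hF.2 a.1 u (D.faceMap_ne_zero a) huv hj a.2
      exact ⟨S, ⟨hS, fun b hb => hI a.1 ha b.1 ⟨_, hS, ⟨a, haS, rfl⟩, b, hb, rfl⟩⟩, haS⟩
    · rintro ⟨S, ⟨-, hS⟩, ha⟩
      exact hS a ha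
  rw [← D.sum_val, hunion, Finset.sum_biUnion]
  · exact Finset.sum_eq_zero fun T hT => F.sum_val_eq_zero (hlabels.1 hT).1
  · intro S hS T hT hne
    refine Finset.disjoint_left.2 fun a haS haT => hne ?_
    exact F.unique u S T (hlabels.1 hS).1 (hlabels.1 hT).1 a haS haT

theorem Complete.isExtendable_sum {F : FaceMultihypergraph D} {v : V} (hF : F.Complete v)
    (hv : D.Extends v) {I : Finset (Fin D.m)} (hI : F.IsLinkClosed I) :
    IsExtendable G s n (∑ i ∈ I, D.x i) v where
  mem_pathChains := Submodule.sum_mem _ fun i _ => D.x_mem i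
  endSet_subset := (endSet_sum_subset I D.x).trans (Set.iUnion_subset hv)
  faceMap_eq_zero _ huv hj := hF.faceMap_sum_eq_zero hI huv hj

theorem isLinkClosed_univ (F : FaceMultihypergraph D) : F.IsLinkClosed Finset.univ :=
  fun _ _ j _ => Finset.mem_univ j

end FaceMultihypergraph

/-- The face data on the `x_i` with `i ∈ I`, renumbered increasingly. -/
def FaceData.restrict (D : FaceData G R s n) (I : Finset (Fin D.m)) : FaceData G R s n where
  m := I.card
  x j := D.x (I.orderEmbOfFin rfl j)
  x_mem _ := D.x_mem _
  x_ne_neg _ _ hij := D.x_ne_neg _ _ ((I.orderEmbOfFin rfl).injective.ne hij)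
  count j := D.count (I.orderEmbOfFin rfl j)
  part j := D.part (I.orderEmbOfFin rfl j)
  part_mem _ := D.part_mem _
  sum_part _ := D.sum_part _
  no_zero_sum _ := D.no_zero_sum _

theorem FaceData.sum_restrict (D : FaceData G R s n) (I : Finset (Fin D.m)) :
    ∑ j, (D.restrict I).x j = ∑ i ∈ I, D.x i := by
  conv_rhs => rw [← Finset.map_orderEmbOfFin_univ I rfl, Finset.sum_map]
  rfl

end FaceMultihypergraph

section Existence

variable {V : Type*} {G : Digraph V} {s : Side} {n : ℤ} {p : ℕ} [hp : Fact p.Prime]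

namespace FaceData

theorem isEdge_or_isLargeHyperedge_of_card_eq (D : FaceData G (ZMod p) s n) {u : V}
    {T : Finset (D.Slot u)} (hcard : T.card = p) (hval : ∀ a ∈ T, ∀ b ∈ T, D.val a = D.val b) :
    D.IsEdge ⟨u, T⟩ ∨ D.IsLargeHyperedge ⟨u, T⟩ := by
  have hne : T.Nonempty := Finset.card_pos.1 (hp.out.pos.trans_eq hcard.symm)
  have h0 : ∑ a ∈ T, D.val a = 0 := by
    obtain ⟨b, hb⟩ := hne
    rw [Finset.sum_eq_card_nsmul fun a ha => hval a ha b hb, hcard,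
      ← Nat.cast_smul_eq_nsmul (ZMod p), CharP.cast_eq_zero, zero_smul]
  obtain ⟨a, ha, b, hb, hab⟩ := exists_ne_vertex_of_sum_val_eq_zero hne h0
  have hne' : a ≠ b := ne_of_apply_ne _ hab
  rcases hp.out.two_le.eq_or_lt with h2 | h3
  · left
    have hT : T = {a, b} := by
      refine (Finset.eq_of_subset_of_card_le ?_ ?_).symm
      · exact Finset.insert_subset ha (Finset.singleton_subset_iff.2 hb)
      · rw [Finset.card_pair hne', hcard, h2]
    rw [hT, Finset.sum_pair hne'] at h0
    exact ⟨a, b, hT, hab, eq_neg_of_add_eq_zero_left h0⟩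
  · exact .inr ⟨h3.trans_eq hcard.symm, ⟨a, ha, b, hb, hab⟩, hval, h0⟩

theorem exists_finpartition_slots (D : FaceData G (ZMod p) s n) {B : Set (Chain V (ZMod p))}
    (hB : LinearIndepOn (ZMod p) id B) (hD : ∀ i u k, D.part i u k ∈ B) {u : V}
    (hu : faceMap s u (∑ i, D.x i) = 0) :
    ∃ P : Finpartition (Finset.univ : Finset (D.Slot u)),
      ∀ T ∈ P.parts, T.card = p ∧ ∀ a ∈ T, ∀ b ∈ T, D.val a = D.val b := by
  classical
  rw [← D.sum_val, Finset.univ_sigma_univ] at hu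
  exact exists_finpartition_fibers (dvd_card_fiber hB (fun a _ => hD a.1 u a.2) hu)

theorem exists_complete (D : FaceData G (ZMod p) s n) {B : Set (Chain V (ZMod p))}
    (hB : LinearIndepOn (ZMod p) id B) (hD : ∀ i u k, D.part i u k ∈ B) {v : V}
    (hface : ∀ u, u ≠ v → ¬ Joins G s u v → faceMap s u (∑ i, D.x i) = 0) :
    ∃ F : FaceMultihypergraph D, F.Complete v := by
  choose P hP using fun (u : V) (huv : u ≠ v) (hj : ¬ Joins G s u v) =>
    D.exists_finpartition_slots hB hD (hface u huv hj)
  let F : FaceMultihypergraph D :=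
    { edges := {e | ∃ (huv : e.1 ≠ v) (hj : ¬ Joins G s e.1 v), e.2 ∈ (P e.1 huv hj).parts}
      valid := by
        rintro ⟨u, T⟩ ⟨huv, hj, hT⟩
        obtain ⟨hcard, hval⟩ := hP u huv hj T hT
        exact D.isEdge_or_isLargeHyperedge_of_card_eq hcard hval
      unique := by
        rintro u S T ⟨huv, hj, hS⟩ ⟨_, _, hT⟩ a haS haT
        exact (P u huv hj).eq_of_mem_parts hS hT haS haT }
  refine ⟨F, fun e he => ⟨he.2.1, he.1⟩, fun i u _ huv hj k => ?_⟩
  obtain ⟨T, hT, hk⟩ := (P u huv hj).exists_mem (Finset.mem_univ (⟨i, k⟩ : D.Slot u))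
  exact ⟨T, ⟨huv, hj, hT⟩, hk⟩

end FaceData

theorem exists_faceData_sum_eq (hG : ∀ v, ¬ G.Adj v v) {E B : Set (Chain V (ZMod p))}
    (hE : E ⊆ pathChains G (ZMod p) n)
    (hB : Submodule.span (ZMod p) B = pathChains G (ZMod p) (n - 1)) {y : Chain V (ZMod p)}
    (hy : y ∈ Submodule.span (ZMod p) E) :
    ∃ D : FaceData G (ZMod p) s n, (∀ i, D.x i ∈ E) ∧ (∀ i u k, D.part i u k ∈ B) ∧
      ∑ i, D.x i = y := by
  obtain ⟨m, x, hx, hsum, hfree⟩ := exists_fin_sum_eq_of_mem_span hy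
  have hface : ∀ i u, faceMap s u (x i) ∈ Submodule.span (ZMod p) B := fun i u =>
    hB ▸ faceMap_mem_pathChains hG (hE (hx i)) u
  choose count part hpart hpart_sum hpart_free using fun i u =>
    exists_fin_sum_eq_of_mem_span (hface i u)
  exact ⟨{
    m := m
    x := x
    x_mem := fun i => hE (hx i)
    x_ne_neg := fun i j hij h => hfree {i, j} (Finset.insert_nonempty _ _) <| by
      rw [Finset.sum_pair hij, h, neg_add_cancel]
    count := count
    part := part
    part_mem := fun i u k => hB ▸ Submodule.subset_span (hpart i u k)
    sum_part := hpart_sum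
    no_zero_sum := hpart_free }, hx, hpart, hsum⟩

end Existence

/-! ### Inductive elements span -/

section Span

variable {V : Type*} {G : Digraph V} {s : Side} {n : ℤ} {p : ℕ}

theorem isInductive_extension {R : Type*} [CommRing R] (hG : ∀ v, ¬ G.Adj v v) (hn : 1 ≤ n)
    {E E' : Set (Chain V R)} {D : FaceData G R s (n - 1)} (hE : ∀ i, D.x i ∈ E)
    (hE' : ∀ i u k, D.part i u k ∈ E') {v : V} (hv : D.Extends v)
    {F : FaceMultihypergraph D} (hF : F.Complete v) (hconn : F.StronglyConnected)
    (hne : extension G s v (∑ i, D.x i) ≠ 0) :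
    IsInductive G s n E E' (extension G s v (∑ i, D.x i)) :=
  ⟨(hF.isExtendable_sum hv F.isLinkClosed_univ).extension_mem_pathChains hG hn, v,
    endSet_extension hne, D, F, hv, rfl, hF, hconn, fun i => .inl (hE i),
    fun i u k => .inl (hE' i u k)⟩

theorem extension_sum_mem_span [Fact p.Prime] (hG : ∀ v, ¬ G.Adj v v) (hn : 1 ≤ n)
    {E E' B : Set (Chain V (ZMod p))} (hBE' : B ⊆ E') (hB : LinearIndepOn (ZMod p) id B)
    (D : FaceData G (ZMod p) s (n - 1)) (hE : ∀ i, D.x i ∈ E) (hpart : ∀ i u k, D.part i u k ∈ B)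
    {v : V} (hv : D.Extends v)
    (hface : ∀ u, u ≠ v → ¬ Joins G s u v → faceMap s u (∑ i, D.x i) = 0) :
    extension G s v (∑ i, D.x i) ∈
      Submodule.span (ZMod p) {x | IsInductive G s n E E' x} := by
  induction D using (measure FaceData.m).wf.induction with
  | _ D ih =>
  obtain ⟨F, hF⟩ := D.exists_complete hB hpart hface
  by_cases hconn : F.StronglyConnected
  · by_cases hne : extension G s v (∑ i, D.x i) = 0
    · rw [hne]
      exact zero_mem _
    · exact Submodule.subset_span
        (isInductive_extension hG hn hE (fun i u k => hBE' (hpart i u k)) hv hF hconn hne)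
  · obtain ⟨F', hFF', hF'⟩ : ∃ F', Relation.EqvGen _ F F' ∧ ¬ F'.Connected := by
      simpa only [FaceMultihypergraph.StronglyConnected, not_forall, exists_prop] using hconn
    have hF'v : F'.Complete v := (FaceMultihypergraph.complete_iff_of_eqvGen hFF' v).2 hF
    obtain ⟨I, hI, hIc, hclosed⟩ := FaceMultihypergraph.exists_isLinkClosed_of_not_connected hF'
    have hpiece : ∀ J : Finset (Fin D.m), Jᶜ.Nonempty → F'.IsLinkClosed J →
        extension G s v (∑ i ∈ J, D.x i) ∈
          Submodule.span (ZMod p) {x | IsInductive G s n E E' x} := by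
      intro J hJ hJclosed
      have hlt : J.card < D.m := by
        simpa using Finset.card_lt_univ_of_notMem (Finset.mem_compl.1 hJ.choose_spec)
      rw [← D.sum_restrict J]
      refine ih (D.restrict J) hlt (fun _ => hE _) (fun _ => hpart _) (fun _ => hv _) ?_
      rw [D.sum_restrict J]
      exact fun u huv hj => hF'v.faceMap_sum_eq_zero hJclosed huv hj
    rw [← Finset.sum_add_sum_compl I, map_add]
    exact add_mem (hpiece I hIc hclosed) (hpiece Iᶜ (by rwa [compl_compl]) hclosed.compl)

theorem span_isInductive [Fact p.Prime] (hG : ∀ v, ¬ G.Adj v v) (hn : 1 ≤ n)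
    {E E' : Set (Chain V (ZMod p))}
    (hE : Submodule.span (ZMod p) E = pathChains G (ZMod p) (n - 1))
    (hE' : Submodule.span (ZMod p) E' = pathChains G (ZMod p) (n - 1 - 1))
    (hends : ∀ x ∈ E, (endSet s x).Subsingleton) :
    Submodule.span (ZMod p) {x | IsInductive G s n E E' x} = pathChains G (ZMod p) n := by
  refine le_antisymm (Submodule.span_le.2 fun x hx => hx.1) fun x hx => ?_
  have hEn : E ⊆ pathChains G (ZMod p) (n - 1) := hE ▸ Submodule.subset_span
  have hnil : ∀ e ∈ E, e [] = 0 := fun e he =>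
    by_contra fun h => (mem_allowedChains.1 (hEn he).1 [] h).1 rfl
  obtain ⟨B, hBE', hBspan, hB⟩ := exists_linearIndependent (ZMod p) E'
  obtain ⟨S, hS⟩ := exists_sum_extension_strip_eq s hx.1
  rw [← hS]
  refine Submodule.sum_mem _ fun v _ => ?_
  have hy : IsExtendable G s (n - 1) (strip (ZMod p) s v x) v :=
    ((mem_pathChains_iff_strip hG hn).1 hx).2 v
  have hspan := mem_span_endSet_subset hnil hends (hE ▸ hy.mem_pathChains) hy.endSet_subset
  obtain ⟨D, hDE, hDB, hsum⟩ := exists_faceData_sum_eq (s := s) hG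
    ((Set.sep_subset E _).trans hEn) (hBspan.trans hE') hspan
  rw [← hsum]
  refine extension_sum_mem_span hG hn hBE' hB D (fun i => (hDE i).1) hDB (fun i => (hDE i).2) ?_
  rw [hsum]
  exact hy.faceMap_eq_zero

theorem endSet_subsingleton_of_mem_inductiveElements {R : Type*} [CommRing R] {k : ℕ}
    {x : Chain V R} (hx : x ∈ inductiveElements G R s k) : (endSet s x).Subsingleton := by
  match k, hx with
  | 0, ⟨v, hv⟩ =>
    refine Set.subsingleton_singleton.anti (t := {v}) fun w hw => ?_
    obtain ⟨l, hl, hlw⟩ := mem_endSet.1 hw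
    obtain rfl : l = [v] := by
      by_contra hne
      rcases hv with rfl | rfl <;> simp [Finsupp.single_eq_of_ne hne] at hl
    cases s <;> exact (Option.some_injective _ hlw).symm
  | 1, ⟨_, v, hv, _⟩ => exact hv ▸ Set.subsingleton_singleton
  | _ + 2, ⟨_, v, hv, _⟩ => exact hv ▸ Set.subsingleton_singleton

theorem span_inductiveElements [Fact p.Prime] (hG : ∀ v, ¬ G.Adj v v) (s : Side) (k : ℕ) :
    Submodule.span (ZMod p) (inductiveElements G (ZMod p) s k) = pathChains G (ZMod p) k := by
  induction k using Nat.twoStepInduction with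
  | zero => exact span_inductiveElements_zero
  | one =>
    refine span_isInductive hG le_rfl span_inductiveElements_zero ?_
      fun x => endSet_subsingleton_of_mem_inductiveElements
    rw [Submodule.span_empty, pathChains_of_neg (by norm_num)]
  | more k ih ih' =>
    have hk : ((k + 2 : ℕ) : ℤ) - 1 = (k + 1 : ℕ) := by omega
    refine span_isInductive hG (by omega) (hk ▸ ih') ?_
      fun x => endSet_subsingleton_of_mem_inductiveElements
    rw [ih]
    congr 1
    omega

end Span

end DigraphPath

theorem mainTheorem1 {V : Type*} (G : Digraph V) (hG : ∀ v, ¬ G.Adj v v)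
    (p : ℕ) (hp : p.Prime) (n : ℕ) :
    (Submodule.span (ZMod p)
        (DigraphPath.inductiveElements G (ZMod p) DigraphPath.Side.upper n) =
      DigraphPath.pathChains G (ZMod p) n ∧
    Submodule.span (ZMod p)
        (DigraphPath.inductiveElements G (ZMod p) DigraphPath.Side.lower n) =
      DigraphPath.pathChains G (ZMod p) n) ∧
    (∃ B ⊆ DigraphPath.inductiveElements G (ZMod p) DigraphPath.Side.upper n,
      ∃ b : Module.Basis B (ZMod p) (DigraphPath.pathChains G (ZMod p) n),
        ∀ x : B, (b x : DigraphPath.Chain V (ZMod p)) = x) ∧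
    (∃ B ⊆ DigraphPath.inductiveElements G (ZMod p) DigraphPath.Side.lower n,
      ∃ b : Module.Basis B (ZMod p) (DigraphPath.pathChains G (ZMod p) n),
        ∀ x : B, (b x : DigraphPath.Chain V (ZMod p)) = x) := by
  have : Fact p.Prime := ⟨hp⟩
  have h := fun s => DigraphPath.span_inductiveElements (p := p) hG s n
  exact ⟨⟨h _, h _⟩, DigraphPath.exists_basis_subset_of_span_eq (h _),
    DigraphPath.exists_basis_subset_of_span_eq (h _)⟩
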